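/- An $(n,N,t)$ spherical code is a set $C$ of exactly $N$ points of the unit sphere $S^{n-1}\subseteq\mathbb{R}^n$ such that $c\cdot c'\le t$ for all distinct $c,c'\in C$. It is called optimal if there is no $(n,N,t')$ spherical code with $t'<t$. The Petersen code is the set of midpoints of the edges of a regular simplex in $\mathbb{R}^4$ (with $5$ vertices), placed and scaled so that all these midpoints lie on the unit sphere $S^3$. Theorem. The Petersen code exists and is an optimal $(4,10,1/6)$ spherical code (in particular it has exactly $10$ points), and the set of inner products between its distinct points is $\{-2/3,\,1/6\}$. Up to orthogonal transformations it is the unique $(4,10,1/6)$ spherical code: for every Petersen code $C$ and every $(4,10,1/6)$ spherical code $C'$ there is an orthogonal transformation $U$ of $\mathbb{R}^4$ with $U(C)=C'$. -/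

import Mathlib

/-- `C` is an `(n, N, t)` spherical code: a set of `N` points of the unit sphere of `ℝⁿ`, any two
distinct ones of which have inner product at most `t`. -/
def IsSphericalCode (n N : ℕ) (t : ℝ) (C : Set (EuclideanSpace ℝ (Fin n))) : Prop :=
  C.encard = N ∧ C ⊆ Metric.sphere 0 1 ∧ ∀ x ∈ C, ∀ y ∈ C, x ≠ y → inner ℝ x y ≤ t

/-- `C` is an optimal `(n, N, t)` spherical code: it is an `(n, N, t)` spherical code, and there is
no `(n, N, t')` spherical code with `t' < t`. -/
def IsOptimalSphericalCode (n N : ℕ) (t : ℝ) (C : Set (EuclideanSpace ℝ (Fin n))) : Prop :=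
  IsSphericalCode n N t C ∧
    ∀ t' < t, ¬ ∃ C' : Set (EuclideanSpace ℝ (Fin n)), IsSphericalCode n N t' C'

/-- The set of midpoints of the edges of a simplex. -/
noncomputable def edgeMidpoints {n m : ℕ} (s : Affine.Simplex ℝ (EuclideanSpace ℝ (Fin n)) m) :
    Set (EuclideanSpace ℝ (Fin n)) :=
  {x | ∃ i j : Fin (m + 1), i < j ∧ x = midpoint ℝ (s.points i) (s.points j)}

/-- `C` is a Petersen code: the set of midpoints of the edges of a regular simplex in dimension `4`,
the simplex being placed and scaled so that these midpoints lie on the unit sphere. (Similarities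
map regular simplices to regular simplices, so none has to be applied separately.) -/
def IsPetersenCode (C : Set (EuclideanSpace ℝ (Fin 4))) : Prop :=
  ∃ s : Affine.Simplex ℝ (EuclideanSpace ℝ (Fin 4)) 4,
    s.Regular ∧ C = edgeMidpoints s ∧ C ⊆ Metric.sphere 0 1

/-!
The Petersen code has inner products `1 / 6` and `-2 / 3` only. That every `(4, 10, 1 / 6)` code
has this property is shown by a semidefinite programming bound for triples of points. Rescale the
inner products to the slacks `a = (1 - 6 * t) / 5`, which are nonnegative for distinct points of a
code, equal to `-1` on the diagonal, and equal to `0` or `1` in the Petersen code. For ten unit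
vectors `p i` of `ℝ⁴` the following quantities add up to zero identically:

* for three polynomials `f` of degree at most three, positive multiples of
  `∑ i, (∑ j, f (a i j)) ^ 2`;
* for two even polynomials `g` of degree two, positive multiples of the sum over `i` of the squared
  norm of `∑ j, g (a i j) • q i j`, where `q i j` is the component of `p j` orthogonal to `p i`;
* a positive multiple of `∑ i, ∑ j, ⟪p i, p j⟫ ^ 2 - 10 ^ 2 / 4`, which is nonnegative because the
  dimension is four (`card_sq_le_sum_inner_sq`);
* the sums of `triplePoly` over triples and of `pairPoly` over pairs of distinct points.

If the slacks of distinct points are nonnegative, then so is every quantity in the list, hence all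
of them vanish. A zero of `pairPoly` is `0` or `1`, which gives `inner_eq_of_card_eq_ten`. The
three-point terms cancel after symmetrization (`sum_triple_of_symmetrization`), so the identity only
has to be verified for polynomials in one slack.

Now call two points adjacent if their inner product is `-2 / 3`. The sum of all points vanishes
(`sum_eq_zero_of_inner_eq`), so every point has three neighbors, and positive semidefiniteness of
Gram matrices excludes triangles and four-cycles. Hence there is a path of four points
(`IsSphericalCode.exists_path`), which form a basis of `ℝ⁴` with a known Gram matrix. Every point of
the code is determined by its inner products with the path, and only ten vectors of inner products
are possible (`IsSphericalCode.inner_mem_pathProfiles`), so all of them occur. Therefore the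
isometry that maps the path of one code to that of another maps the first code onto the second.
Optimality follows from uniqueness: a better code would be congruent to the Petersen code, which
has two points with inner product `1 / 6`.

In a Petersen code, the regular simplex has to be centered at the origin
(`inner_points_of_edgeMidpoints_subset_sphere`), since otherwise its five vertices would be linearly
independent. This fixes all inner products. Existence is shown with an explicit simplex, whose
symmetries are again isometries between bases with equal Gram matrices.
-/

open scoped RealInnerProductSpace

/-! ### Sums over pairs and triples -/

section Sums

variable {ι : Type*} [Fintype ι]

/-- If the symmetrization of `φ` over the six permutations of its arguments splits into a sum of
functions of one variable, then the sum of `φ` over all triples reduces to a sum over pairs. -/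
theorem sum_triple_of_symmetrization {A : ι → ι → ℝ} (hA : ∀ i j, A i j = A j i)
    (φ : ℝ → ℝ → ℝ → ℝ) (w : ℝ → ℝ)
    (h : ∀ a b c, φ a b c + φ a c b + φ b a c + φ b c a + φ c a b + φ c b a
      = 2 * (w a + w b + w c)) :
    ∑ i, ∑ j, ∑ k, φ (A i j) (A i k) (A j k) = Fintype.card ι * ∑ i, ∑ j, w (A i j) := by
  set S := ∑ i, ∑ j, ∑ k, φ (A i j) (A i k) (A j k) with hS
  have swap12 : ∀ g : ι → ι → ι → ℝ, ∑ i, ∑ j, ∑ k, g i j k = ∑ i, ∑ j, ∑ k, g j i k :=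
    fun g => Finset.sum_comm
  have swap23 : ∀ g : ι → ι → ι → ℝ, ∑ i, ∑ j, ∑ k, g i j k = ∑ i, ∑ j, ∑ k, g i k j :=
    fun g => Finset.sum_congr rfl fun i _ => Finset.sum_comm
  have hacb : ∑ i, ∑ j, ∑ k, φ (A i j) (A j k) (A i k) = S := by
    rw [swap12, hS]
    exact Finset.sum_congr rfl fun i _ => Finset.sum_congr rfl fun j _ =>
      Finset.sum_congr rfl fun k _ => by rw [hA j i]
  have hbac : ∑ i, ∑ j, ∑ k, φ (A i k) (A i j) (A j k) = S := by
    rw [swap23, hS]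
    exact Finset.sum_congr rfl fun i _ => Finset.sum_congr rfl fun j _ =>
      Finset.sum_congr rfl fun k _ => by rw [hA k j]
  have hbca : ∑ i, ∑ j, ∑ k, φ (A i k) (A j k) (A i j) = S := by
    rw [swap23, ← hacb]
    exact Finset.sum_congr rfl fun i _ => Finset.sum_congr rfl fun j _ =>
      Finset.sum_congr rfl fun k _ => by rw [hA k j]
  have hcab : ∑ i, ∑ j, ∑ k, φ (A j k) (A i j) (A i k) = S := by
    rw [swap12, ← hbac]
    exact Finset.sum_congr rfl fun i _ => Finset.sum_congr rfl fun j _ =>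
      Finset.sum_congr rfl fun k _ => by rw [hA j i]
  have hcba : ∑ i, ∑ j, ∑ k, φ (A j k) (A i k) (A i j) = S := by
    rw [swap23, ← hcab]
    exact Finset.sum_congr rfl fun i _ => Finset.sum_congr rfl fun j _ =>
      Finset.sum_congr rfl fun k _ => by rw [hA k j]
  set W := ∑ i, ∑ j, w (A i j) with hW
  have h1 : ∑ i, ∑ j, ∑ _k : ι, w (A i j) = Fintype.card ι * W := by
    simp only [Finset.sum_const, Finset.card_univ, nsmul_eq_mul, ← Finset.mul_sum, hW]
  have h2 : ∑ i, ∑ _j : ι, ∑ k, w (A i k) = Fintype.card ι * W := by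
    rw [swap23, h1]
  have h3 : ∑ _i : ι, ∑ j, ∑ k, w (A j k) = Fintype.card ι * W := by
    rw [swap12, h2]
  have key : ∑ i, ∑ j, ∑ k, (φ (A i j) (A i k) (A j k) + φ (A i j) (A j k) (A i k)
      + φ (A i k) (A i j) (A j k) + φ (A i k) (A j k) (A i j) + φ (A j k) (A i j) (A i k)
      + φ (A j k) (A i k) (A i j))
      = ∑ i, ∑ j, ∑ k, 2 * (w (A i j) + w (A i k) + w (A j k)) :=
    Finset.sum_congr rfl fun i _ => Finset.sum_congr rfl fun j _ =>
      Finset.sum_congr rfl fun k _ => h _ _ _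
  simp only [Finset.sum_add_distrib, ← Finset.mul_sum] at key
  rw [hacb, hbac, hbca, hcab, hcba, h1, h2, h3] at key
  linarith

/-- Inclusion-exclusion for the sum over the triples of distinct indices. -/
theorem sum_distinct_triple [DecidableEq ι] (s : ι → ι → ι → ℝ) :
    ∑ i, ∑ j, ∑ k, (if i ≠ j ∧ i ≠ k ∧ j ≠ k then s i j k else 0)
      = ∑ i, ∑ j, ∑ k, s i j k - ∑ i, ∑ j, (s i i j + s i j i + s i j j) + 2 * ∑ i, s i i i := by
  have hpt : ∀ i j k, (if i ≠ j ∧ i ≠ k ∧ j ≠ k then s i j k else 0)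
      = s i j k - (if i = j then s i j k else 0) - (if i = k then s i j k else 0)
        - (if j = k then s i j k else 0) + 2 * (if i = j then if i = k then s i j k else 0 else 0) := by
    intro i j k
    by_cases h1 : i = j <;> by_cases h2 : i = k <;> by_cases h3 : j = k <;>
      (simp_all; try ring)
  simp only [hpt, Finset.sum_add_distrib, Finset.sum_sub_distrib, ← Finset.mul_sum,
    Finset.sum_ite_eq, Finset.mem_univ, if_true]
  have e1 : ∑ i, ∑ j, ∑ k, (if i = j then s i j k else 0) = ∑ i, ∑ j, s i i j := by
    refine Finset.sum_congr rfl fun i _ => ?_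
    rw [Finset.sum_comm]
    simp
  have e2 : ∑ i, ∑ j, ∑ k, (if i = j then if i = k then s i j k else 0 else 0) = ∑ i, s i i i := by
    refine Finset.sum_congr rfl fun i _ => ?_
    rw [Finset.sum_comm]
    simp
  rw [e1, e2]
  ring

theorem sum_distinct_pair [DecidableEq ι] (s : ι → ι → ℝ) :
    ∑ i, ∑ j, (if i ≠ j then s i j else 0) = ∑ i, ∑ j, s i j - ∑ i, s i i := by
  have hpt : ∀ i j, (if i ≠ j then s i j else 0) = s i j - (if i = j then s i j else 0) := by
    intro i j
    by_cases h : i = j <;> simp [h]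
  simp [hpt, Finset.sum_sub_distrib]

end Sums

/-! ### Positive semidefinite kernels on the sphere -/

section Kernels

variable {ι : Type*} [Fintype ι]

theorem sum_sq_eq_sum_triple (f : ℝ → ℝ) (A : ι → ι → ℝ) :
    ∑ i, (∑ j, f (A i j)) ^ 2 = ∑ i, ∑ j, ∑ k, f (A i j) * f (A i k) :=
  Finset.sum_congr rfl fun i _ => by rw [sq, Finset.sum_mul_sum]

/-- The kernel `⟪y, z⟫ - ⟪x, y⟫ * ⟪x, z⟫` is positive semidefinite: it is the inner product of the
components of `y` and `z` orthogonal to the unit vector `x`. -/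
theorem sum_mul_inner_sub_nonneg {E : Type*} [NormedAddCommGroup E] [InnerProductSpace ℝ E]
    {x : E} (hx : ‖x‖ = 1) (p : ι → E) (c : ι → ℝ) :
    0 ≤ ∑ j, ∑ k, c j * c k * (⟪p j, p k⟫ - ⟪x, p j⟫ * ⟪x, p k⟫) := by
  have hxx : ⟪x, x⟫ = 1 := by rw [real_inner_self_eq_norm_sq, hx]; norm_num
  have h : ⟪∑ j, c j • (p j - ⟪x, p j⟫ • x), ∑ k, c k • (p k - ⟪x, p k⟫ • x)⟫
      = ∑ j, ∑ k, c j * c k * (⟪p j, p k⟫ - ⟪x, p j⟫ * ⟪x, p k⟫) := by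
    simp only [sum_inner, inner_sum, real_inner_smul_left, real_inner_smul_right, inner_sub_left,
      inner_sub_right, hxx]
    rw [Finset.sum_comm]
    refine Finset.sum_congr rfl fun j _ => Finset.sum_congr rfl fun k _ => ?_
    rw [real_inner_comm x (p j)]
    ring
  rw [← h]
  exact real_inner_self_nonneg

/-- The average of the squared inner products of unit vectors of `ℝ⁴` is at least `1 / 4`: this is
the Cauchy-Schwarz inequality for the second moment matrix, whose trace is the number of vectors. -/
theorem card_sq_le_sum_inner_sq {p : ι → EuclideanSpace ℝ (Fin 4)} (hp : ∀ i, ‖p i‖ = 1) :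
    (Fintype.card ι : ℝ) ^ 2 / 4 ≤ ∑ i, ∑ j, ⟪p i, p j⟫ ^ 2 := by
  set M : Fin 4 → Fin 4 → ℝ := fun a b => ∑ i, p i a * p i b with hM
  have h1 : ∑ i, ∑ j, ⟪p i, p j⟫ ^ 2 = ∑ a, ∑ b, M a b ^ 2 := by
    have hin : ∀ i j, ⟪p i, p j⟫ = ∑ a, p i a * p j a := by
      intro i j
      simp [PiLp.inner_apply, mul_comm]
    have hl : ∀ i j, ⟪p i, p j⟫ ^ 2 = ∑ a, ∑ b, p i a * p i b * (p j a * p j b) := by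
      intro i j
      rw [hin, sq, Finset.sum_mul_sum]
      exact Finset.sum_congr rfl fun a _ => Finset.sum_congr rfl fun b _ => by ring
    have hr : ∀ a b, M a b ^ 2 = ∑ i, ∑ j, p i a * p i b * (p j a * p j b) := by
      intro a b
      rw [hM, sq, Finset.sum_mul_sum]
    simp only [hl, hr]
    calc ∑ i, ∑ j, ∑ a, ∑ b, p i a * p i b * (p j a * p j b)
        = ∑ i, ∑ a, ∑ b, ∑ j, p i a * p i b * (p j a * p j b) := by
          refine Finset.sum_congr rfl fun i _ => ?_
          rw [Finset.sum_comm]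
          exact Finset.sum_congr rfl fun a _ => Finset.sum_comm
      _ = ∑ a, ∑ b, ∑ i, ∑ j, p i a * p i b * (p j a * p j b) := by
          rw [Finset.sum_comm]
          exact Finset.sum_congr rfl fun a _ => Finset.sum_comm
  have htr : ∑ a, M a a = Fintype.card ι := by
    rw [hM, Finset.sum_comm]
    have : ∀ i, ∑ a, p i a * p i a = 1 := by
      intro i
      have := EuclideanSpace.real_norm_sq_eq (p i)
      rw [hp i] at this
      rw [← one_pow 2, this]
      exact Finset.sum_congr rfl fun a _ => by ring
    simp [this]
  have hdiag : ∑ a, M a a ^ 2 ≤ ∑ a, ∑ b, M a b ^ 2 :=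
    Finset.sum_le_sum fun a _ =>
      Finset.single_le_sum (f := fun b => M a b ^ 2) (fun b _ => sq_nonneg _) (Finset.mem_univ a)
  have hcs := sq_sum_le_card_mul_sum_sq (s := (Finset.univ : Finset (Fin 4))) (f := fun a => M a a)
  rw [htr] at hcs
  simp only [Finset.card_univ, Fintype.card_fin] at hcs
  rw [h1]
  push_cast at hcs
  linarith

end Kernels

/-! ### The certificate -/

section Certificate

variable {ι : Type*} [Fintype ι] {p : ι → EuclideanSpace ℝ (Fin 4)}

/-- The affine rescaling of the inner product of two unit vectors under which `1`, `1 / 6` and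
`-2 / 3` become `-1`, `0` and `1`. -/
noncomputable def slack (x y : EuclideanSpace ℝ (Fin 4)) : ℝ :=
  (1 - 6 * ⟪x, y⟫) / 5

theorem slack_comm (x y : EuclideanSpace ℝ (Fin 4)) : slack x y = slack y x := by
  rw [slack, slack, real_inner_comm]

theorem inner_eq_slack (x y : EuclideanSpace ℝ (Fin 4)) : ⟪x, y⟫ = (1 - 5 * slack x y) / 6 := by
  rw [slack]
  ring

theorem slack_self {x : EuclideanSpace ℝ (Fin 4)} (hx : ‖x‖ = 1) : slack x x = -1 := by
  rw [slack, real_inner_self_eq_norm_sq, hx]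
  norm_num

/-- The combination of positive semidefinite three-point kernels used in the certificate, for a
triple of unit vectors with pairwise slacks `a`, `b`, `c`. A point of the Petersen code has slack
`-1`, `0` and `1` with one, six and three points, so the sums of the polynomials `f` in the first
three terms vanish there because `f (-1) + 6 * f 0 + 3 * f 1 = 0`. The coefficients are a rational
solution of a semidefinite program. -/
noncomputable def kernelPoly (a b c : ℝ) : ℝ :=
  10 / 3 * ((a ^ 3 - 7 / 20 * a ^ 2 + a / 20 - 7 / 100) * (b ^ 3 - 7 / 20 * b ^ 2 + b / 20 - 7 / 100))
  + 11 / 120 * ((1 + a - 3 * a ^ 2) * (1 + b - 3 * b ^ 2))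
  + 1 / 10 * ((a ^ 2 - 2 / 5) * (b ^ 2 - 2 / 5))
  + 2 / 125 * ((3 + 5 * a ^ 2) * (3 + 5 * b ^ 2)
      * ((1 - 5 * c) / 6 - (1 - 5 * a) / 6 * ((1 - 5 * b) / 6)))
  + 22 / 5 * (a ^ 2 * b ^ 2 * ((1 - 5 * c) / 6 - (1 - 5 * a) / 6 * ((1 - 5 * b) / 6)))

theorem sum_kernelPoly_nonneg (hp : ∀ i, ‖p i‖ = 1) :
    0 ≤ ∑ i, ∑ j, ∑ k, kernelPoly (slack (p i) (p j)) (slack (p i) (p k)) (slack (p j) (p k)) := by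
  have hsq : ∀ f : ℝ → ℝ,
      0 ≤ ∑ i, ∑ j, ∑ k, f (slack (p i) (p j)) * f (slack (p i) (p k)) := by
    intro f
    rw [← sum_sq_eq_sum_triple f (fun i j => slack (p i) (p j))]
    exact Finset.sum_nonneg fun i _ => sq_nonneg _
  have hperp : ∀ g : ℝ → ℝ, 0 ≤ ∑ i, ∑ j, ∑ k, g (slack (p i) (p j)) * g (slack (p i) (p k))
      * ((1 - 5 * slack (p j) (p k)) / 6
        - (1 - 5 * slack (p i) (p j)) / 6 * ((1 - 5 * slack (p i) (p k)) / 6)) := by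
    intro g
    simp only [← inner_eq_slack]
    exact Finset.sum_nonneg fun i _ =>
      sum_mul_inner_sub_nonneg (hp i) p fun j => g (slack (p i) (p j))
  have h1 := hsq fun a => a ^ 3 - 7 / 20 * a ^ 2 + a / 20 - 7 / 100
  have h2 := hsq fun a => 1 + a - 3 * a ^ 2
  have h3 := hsq fun a => a ^ 2 - 2 / 5
  have h4 := hperp fun a => 3 + 5 * a ^ 2
  have h5 := hperp fun a => a ^ 2
  simp only [← Finset.mul_sum] at h1 h2 h3
  simp only [kernelPoly, Finset.sum_add_distrib, ← Finset.mul_sum]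
  linarith

/-- The nonnegative contribution of a triple of distinct points to the certificate. -/
def triplePoly (a b c : ℝ) : ℝ :=
  4 * a * b ^ 2 * c ^ 2 + a * (a - 1) ^ 2 * b ^ 2

/-- The nonnegative contribution of a pair of distinct points to the certificate. Among the
nonnegative numbers it vanishes only at `0` and `1`. -/
def pairPoly (a : ℝ) : ℝ :=
  a * (a - 1) ^ 2 * ((a - 2) ^ 2 + 1)

/-- Ten unit vectors of `ℝ⁴` with pairwise inner products at most `1 / 6` have pairwise inner
products `1 / 6` and `-2 / 3` only. -/
theorem inner_eq_of_card_eq_ten [DecidableEq ι] (hcard : Fintype.card ι = 10)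
    (hp : ∀ i, ‖p i‖ = 1) (hip : ∀ i j, i ≠ j → ⟪p i, p j⟫ ≤ 1 / 6) {i j : ι} (hij : i ≠ j) :
    ⟪p i, p j⟫ = 1 / 6 ∨ ⟪p i, p j⟫ = -2 / 3 := by
  set A : ι → ι → ℝ := fun i j => slack (p i) (p j) with hA
  have hself : ∀ i, A i i = -1 := fun i => slack_self (hp i)
  have hcomm : ∀ i j, A i j = A j i := fun i j => slack_comm _ _
  have hnn : ∀ i j, i ≠ j → 0 ≤ A i j := by
    intro i j h
    have := hip i j h
    simp only [hA, slack]
    linarith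
  have hF : 0 ≤ ∑ i, ∑ j, ∑ k, kernelPoly (A i j) (A i k) (A j k) := sum_kernelPoly_nonneg hp
  have hD : (10 : ℝ) ^ 2 / 4 ≤ ∑ i, ∑ j, ((1 - 5 * A i j) / 6) ^ 2 := by
    have := card_sq_le_sum_inner_sq hp
    rw [hcard] at this
    simpa only [inner_eq_slack, Nat.cast_ofNat] using this
  have hS : 0 ≤ ∑ i, ∑ j, ∑ k,
      if i ≠ j ∧ i ≠ k ∧ j ≠ k then triplePoly (A i j) (A i k) (A j k) else 0 := by
    refine Finset.sum_nonneg fun i _ => Finset.sum_nonneg fun j _ => Finset.sum_nonneg fun k _ => ?_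
    split_ifs with h
    · have := hnn i j h.1
      unfold triplePoly
      positivity
    · exact le_rfl
  rw [sum_distinct_triple fun i j k => triplePoly (A i j) (A i k) (A j k)] at hS
  have hpair : ∀ i j, 0 ≤ if i ≠ j then pairPoly (A i j) else 0 := by
    intro i j
    split_ifs with h
    · have := hnn i j h
      unfold pairPoly
      positivity
    · exact le_rfl
  -- The symmetrization of the three-point terms depends on the pairs only.
  have hsum := sum_triple_of_symmetrization hcomm (fun a b c => kernelPoly a b c + triplePoly a b c)
    (fun a => 18 / 125 + 2 / 25 * a - 2 / 5 * a ^ 2 - 2 / 5 * a ^ 3)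
    (by intro a b c; simp only [kernelPoly, triplePoly]; ring)
  simp only [Finset.sum_add_distrib] at hsum
  -- All remaining terms are sums over pairs, and their total is the constant `-12 / 5`.
  have hconst : ∑ i, ∑ j, (10 * (18 / 125 + 2 / 25 * A i j - 2 / 5 * A i j ^ 2 - 2 / 5 * A i j ^ 3)
      + 432 / 25 * (((1 - 5 * A i j) / 6) ^ 2 - 1 / 4)
      - (triplePoly (A i i) (A i j) (A i j) + triplePoly (A i j) (A i i) (A j i)
        + triplePoly (A i j) (A i j) (A j j))
      + pairPoly (A i j)) = -240 := by
    have : ∀ i j, (10 * (18 / 125 + 2 / 25 * A i j - 2 / 5 * A i j ^ 2 - 2 / 5 * A i j ^ 3)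
      + 432 / 25 * (((1 - 5 * A i j) / 6) ^ 2 - 1 / 4)
      - (triplePoly (A i i) (A i j) (A i j) + triplePoly (A i j) (A i i) (A j i)
        + triplePoly (A i j) (A i j) (A j j))
      + pairPoly (A i j)) = -12 / 5 := by
      intro i j
      rw [hself, hself, hcomm j i]
      simp only [triplePoly, pairPoly]
      ring
    simp only [this, Finset.sum_const, Finset.card_univ, hcard]
    norm_num
  have hdiag : ∑ i, pairPoly (A i i) = -400 := by
    simp only [hself, pairPoly, Finset.sum_const, Finset.card_univ, hcard]
    norm_num
  have hdiag3 : ∑ i, triplePoly (A i i) (A i i) (A i i) = -80 := by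
    simp only [hself, triplePoly, Finset.sum_const, Finset.card_univ, hcard]
    norm_num
  have hle : ∑ i, ∑ j, (if i ≠ j then pairPoly (A i j) else 0) ≤ 0 := by
    rw [sum_distinct_pair fun i j => pairPoly (A i j)]
    rw [hcard] at hsum
    simp only [Finset.sum_add_distrib, Finset.sum_sub_distrib, ← Finset.mul_sum] at hconst hS hsum
    have h4 : ∑ _i : ι, ∑ _j : ι, (1 / 4 : ℝ) = 25 := by
      simp only [Finset.sum_const, Finset.card_univ, hcard]
      norm_num
    rw [h4] at hconst
    push_cast at hsum
    linarith
  have hzero : pairPoly (A i j) = 0 := by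
    refine le_antisymm ?_ (by simpa [hij] using hpair i j)
    calc pairPoly (A i j) = if i ≠ j then pairPoly (A i j) else 0 := by simp [hij]
      _ ≤ ∑ j, (if i ≠ j then pairPoly (A i j) else 0) :=
        Finset.single_le_sum (f := fun j => if i ≠ j then pairPoly (A i j) else 0)
          (fun j _ => hpair i j) (Finset.mem_univ j)
      _ ≤ ∑ i, ∑ j, (if i ≠ j then pairPoly (A i j) else 0) :=
        Finset.single_le_sum (f := fun i => ∑ j, (if i ≠ j then pairPoly (A i j) else 0))
          (fun i _ => Finset.sum_nonneg fun j _ => hpair i j) (Finset.mem_univ i)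
      _ ≤ 0 := hle
  have hne : (A i j - 2) ^ 2 + 1 ≠ 0 := by positivity
  rw [inner_eq_slack]
  rcases mul_eq_zero.1 ((mul_eq_zero.1 hzero).resolve_right hne) with h | h
  · left
    change (1 - 5 * A i j) / 6 = _
    rw [h]
    norm_num
  · right
    change (1 - 5 * A i j) / 6 = _
    rw [sub_eq_zero.1 (pow_eq_zero_iff two_ne_zero |>.1 h)]
    norm_num

end Certificate

/-! ### Vectors determined by inner products -/

section Gram

variable {b b' : Fin 4 → EuclideanSpace ℝ (Fin 4)}

theorem ext_inner_of_linearIndependent (hb : LinearIndependent ℝ b)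
    {v w : EuclideanSpace ℝ (Fin 4)} (h : ∀ i, ⟪v, b i⟫ = ⟪w, b i⟫) : v = w := by
  let B := basisOfLinearIndependentOfCardEqFinrank hb (by simp)
  refine ext_inner_right ℝ fun y => ?_
  rw [← B.sum_repr y]
  simp [B, inner_sum, real_inner_smul_right, h]

theorem exists_linearIsometryEquiv_of_inner_eq (hb : LinearIndependent ℝ b)
    (hb' : LinearIndependent ℝ b') (h : ∀ i j, ⟪b i, b j⟫ = ⟪b' i, b' j⟫) :
    ∃ U : EuclideanSpace ℝ (Fin 4) ≃ₗᵢ[ℝ] EuclideanSpace ℝ (Fin 4), ∀ i, U (b i) = b' i := by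
  let B := basisOfLinearIndependentOfCardEqFinrank hb (by simp)
  let B' := basisOfLinearIndependentOfCardEqFinrank hb' (by simp)
  let e := B.equiv B' (Equiv.refl _)
  have he : ∀ i, e (b i) = b' i := by
    intro i
    have := B.equiv_apply i B' (Equiv.refl _)
    simpa [B, B'] using this
  have hinner : ∀ x y, ⟪e x, e y⟫ = ⟪x, y⟫ := by
    intro x y
    rw [← B.sum_repr x, ← B.sum_repr y]
    have hB : ∀ i, B i = b i := by simp [B]
    simp only [map_sum, map_smul, sum_inner, inner_sum, real_inner_smul_left,
      real_inner_smul_right, hB, he, h]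
  exact ⟨e.isometryOfInner hinner, fun i => he i⟩

end Gram

/-! ### The structure of a code -/

section Structure

variable {ι : Type*} [Fintype ι] [DecidableEq ι] {p : ι → EuclideanSpace ℝ (Fin 4)}

/-- The sum of squared inner products and the sum of inner products determine each other, and the
second moment bound makes the latter, which is the squared norm of the sum, nonpositive. -/
theorem sum_eq_zero_of_inner_eq (hcard : Fintype.card ι = 10) (hp : ∀ i, ‖p i‖ = 1)
    (h : ∀ i j, i ≠ j → ⟪p i, p j⟫ = 1 / 6 ∨ ⟪p i, p j⟫ = -2 / 3) : ∑ i, p i = 0 := by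
  have hsq : ∀ i j, ⟪p i, p j⟫ ^ 2 = -⟪p i, p j⟫ / 2 + 1 / 9 + if i = j then 25 / 18 else 0 := by
    intro i j
    by_cases hij : i = j
    · subst hij
      rw [real_inner_self_eq_norm_sq, hp]
      norm_num
    · rcases h i j hij with h | h <;> simp [h, hij] <;> norm_num
  have hD := card_sq_le_sum_inner_sq hp
  have hn : ⟪∑ i, p i, ∑ j, p j⟫ = ∑ i, ∑ j, ⟪p i, p j⟫ := by
    simp only [sum_inner, inner_sum]
    rw [Finset.sum_comm]
  simp only [hsq, Finset.sum_add_distrib, ← Finset.sum_div, Finset.sum_neg_distrib,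
    Finset.sum_ite_eq, Finset.mem_univ, if_true, Finset.sum_const, Finset.card_univ, hcard,
    ← hn] at hD
  norm_num at hD
  rw [← norm_eq_zero, ← sq_eq_zero_iff]
  exact le_antisymm (by linarith) (sq_nonneg _)

theorem card_neighbors_eq_three (hcard : Fintype.card ι = 10) (hp : ∀ i, ‖p i‖ = 1)
    (h : ∀ i j, i ≠ j → ⟪p i, p j⟫ = 1 / 6 ∨ ⟪p i, p j⟫ = -2 / 3) (i : ι) :
    (Finset.univ.filter fun j => ⟪p i, p j⟫ = -2 / 3).card = 3 := by
  have hs : ∑ j, ⟪p i, p j⟫ = 0 := by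
    rw [← inner_sum, sum_eq_zero_of_inner_eq hcard hp h, inner_zero_right]
  have hv : ∀ j, ⟪p i, p j⟫
      = 1 / 6 + (if i = j then 5 / 6 else 0) - 5 / 6 * (if ⟪p i, p j⟫ = -2 / 3 then 1 else 0) := by
    intro j
    by_cases hij : i = j
    · subst hij
      rw [real_inner_self_eq_norm_sq, hp]
      norm_num
    · rcases h i j hij with h | h <;> simp [h, hij] <;> norm_num
  rw [Finset.sum_congr rfl fun j _ => hv j] at hs
  simp only [Finset.sum_sub_distrib, Finset.sum_add_distrib, ← Finset.mul_sum, Finset.sum_ite_eq,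
    Finset.mem_univ, if_true, Finset.sum_const, Finset.card_univ, hcard, Finset.sum_boole] at hs
  norm_num at hs
  have : ((Finset.univ.filter fun j => ⟪p i, p j⟫ = -2 / 3).card : ℝ) = 3 := by
    norm_num
    linarith
  exact_mod_cast this

end Structure

section Path

/-- The Gram matrix of a path with three edges, an edge being an inner product `-2 / 3`. -/
noncomputable def pathGram : Fin 4 → Fin 4 → ℝ :=
  ![![1, -2 / 3, 1 / 6, 1 / 6], ![-2 / 3, 1, -2 / 3, 1 / 6], ![1 / 6, -2 / 3, 1, -2 / 3],
    ![1 / 6, 1 / 6, -2 / 3, 1]]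

/-- The inner products of the points of a code with the vertices of a path. The first four rows
belong to the vertices of the path. In the other rows the entries `-2 / 3` mark an independent set
of the path that does not consist of two vertices with a common neighbor. -/
noncomputable def pathProfiles : Finset (Fin 4 → ℝ) :=
  {pathGram 0, pathGram 1, pathGram 2, pathGram 3,
    ![1 / 6, 1 / 6, 1 / 6, 1 / 6], ![-2 / 3, 1 / 6, 1 / 6, 1 / 6], ![1 / 6, -2 / 3, 1 / 6, 1 / 6],
    ![1 / 6, 1 / 6, -2 / 3, 1 / 6], ![1 / 6, 1 / 6, 1 / 6, -2 / 3], ![-2 / 3, 1 / 6, 1 / 6, -2 / 3]}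

theorem card_pathProfiles_le : pathProfiles.card ≤ 10 :=
  (Finset.card_insert_le _ _).trans <| Nat.succ_le_succ <|
    (Finset.card_insert_le _ _).trans <| Nat.succ_le_succ <|
    (Finset.card_insert_le _ _).trans <| Nat.succ_le_succ <|
    (Finset.card_insert_le _ _).trans <| Nat.succ_le_succ Finset.card_le_six

theorem linearIndependent_of_inner_eq_pathGram {b : Fin 4 → EuclideanSpace ℝ (Fin 4)}
    (hb : ∀ i j, ⟪b i, b j⟫ = pathGram i j) : LinearIndependent ℝ b := by
  rw [Fintype.linearIndependent_iff]
  intro g hg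
  have h : ∀ j, ∑ i, g i * pathGram i j = 0 := by
    intro j
    have := congrArg (fun v => ⟪v, b j⟫) hg
    simpa [sum_inner, real_inner_smul_left, hb] using this
  have h0 := h 0
  have h1 := h 1
  have h2 := h 2
  have h3 := h 3
  simp [Fin.sum_univ_four, pathGram] at h0 h1 h2 h3
  intro i
  fin_cases i <;> simp <;> linarith

variable {E : Type*} [NormedAddCommGroup E] [InnerProductSpace ℝ E] {x y z w : E}

/-- The squared norm of the sum of a triangle would be negative. -/
theorem not_triangle (hx : ‖x‖ = 1) (hy : ‖y‖ = 1) (hz : ‖z‖ = 1) (hxy : ⟪x, y⟫ = -2 / 3)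
    (hyz : ⟪y, z⟫ = -2 / 3) (hxz : ⟪x, z⟫ = -2 / 3) : False := by
  have h : 0 ≤ ⟪x + y + z, x + y + z⟫ := real_inner_self_nonneg
  simp only [inner_add_left, inner_add_right, real_inner_self_eq_norm_sq, hx, hy, hz, hxy, hyz, hxz,
    real_inner_comm x y, real_inner_comm x z, real_inner_comm y z] at h
  norm_num at h

/-- The squared norm of the sum of a four-cycle with diagonals at most `1 / 6` would be negative. -/
theorem not_four_cycle (hx : ‖x‖ = 1) (hy : ‖y‖ = 1) (hz : ‖z‖ = 1) (hw : ‖w‖ = 1)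
    (hxy : ⟪x, y⟫ = -2 / 3) (hyz : ⟪y, z⟫ = -2 / 3) (hzw : ⟪z, w⟫ = -2 / 3)
    (hwx : ⟪w, x⟫ = -2 / 3) (hxz : ⟪x, z⟫ ≤ 1 / 6) (hyw : ⟪y, w⟫ ≤ 1 / 6) : False := by
  have h : 0 ≤ ⟪x + y + z + w, x + y + z + w⟫ := real_inner_self_nonneg
  simp only [inner_add_left, inner_add_right, real_inner_self_eq_norm_sq, hx, hy, hz, hw, hxy, hyz,
    hzw, hwx, real_inner_comm x y, real_inner_comm x z, real_inner_comm y z, real_inner_comm y w,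
    real_inner_comm z w, real_inner_comm w x] at h
  norm_num at h
  linarith

end Path

/-! ### Uniqueness -/

section Uniqueness

variable {C : Set (EuclideanSpace ℝ (Fin 4))}

theorem IsSphericalCode.norm_eq_one {n N : ℕ} {t : ℝ} {C : Set (EuclideanSpace ℝ (Fin n))}
    (hC : IsSphericalCode n N t C) {v : EuclideanSpace ℝ (Fin n)} (hv : v ∈ C) : ‖v‖ = 1 := by
  simpa using hC.2.1 hv

theorem IsSphericalCode.exists_fintype {n N : ℕ} {t : ℝ} {C : Set (EuclideanSpace ℝ (Fin n))}
    (hC : IsSphericalCode n N t C) : ∃ _ : Fintype C, Fintype.card C = N := by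
  let _ : Fintype C := (Set.finite_of_encard_eq_coe hC.1).fintype
  have := hC.1
  rw [Set.encard_eq_coe_toFinset_card, Set.toFinset_card] at this
  exact ⟨inferInstance, mod_cast this⟩

theorem IsSphericalCode.inner_eq (hC : IsSphericalCode 4 10 (1 / 6) C)
    {v w : EuclideanSpace ℝ (Fin 4)} (hv : v ∈ C) (hw : w ∈ C) (hvw : v ≠ w) :
    ⟪v, w⟫ = 1 / 6 ∨ ⟪v, w⟫ = -2 / 3 := by
  classical
  obtain ⟨_, hcard⟩ := hC.exists_fintype
  exact inner_eq_of_card_eq_ten (p := fun c : C => (c : EuclideanSpace ℝ (Fin 4))) hcard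
    (fun c => hC.norm_eq_one c.2) (fun i j h => hC.2.2 i i.2 j j.2 (Subtype.coe_injective.ne h))
    (i := ⟨v, hv⟩) (j := ⟨w, hw⟩) (by simpa using hvw)

/-- A point of a code has at least two neighbors, so one of them differs from any given point. -/
theorem IsSphericalCode.exists_neighbor_ne (hC : IsSphericalCode 4 10 (1 / 6) C)
    {v : EuclideanSpace ℝ (Fin 4)} (hv : v ∈ C) (u : EuclideanSpace ℝ (Fin 4)) :
    ∃ w ∈ C, w ≠ u ∧ ⟪v, w⟫ = -2 / 3 := by
  classical
  obtain ⟨_, hcard⟩ := hC.exists_fintype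
  have h3 := card_neighbors_eq_three (p := fun c : C => (c : EuclideanSpace ℝ (Fin 4))) hcard
    (fun c => hC.norm_eq_one c.2)
    (fun i j h => hC.inner_eq i.2 j.2 (Subtype.coe_injective.ne h)) ⟨v, hv⟩
  by_contra! hcon
  have hsub : ∀ a ∈ Finset.univ.filter fun j : C => ⟪v, (j : EuclideanSpace ℝ (Fin 4))⟫ = -2 / 3,
      (a : EuclideanSpace ℝ (Fin 4)) = u := by
    intro a ha
    by_contra hne
    exact hcon a a.2 hne (Finset.mem_filter.1 ha).2
  have : (Finset.univ.filter fun j : C => ⟪v, (j : EuclideanSpace ℝ (Fin 4))⟫ = -2 / 3).card ≤ 1 :=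
    Finset.card_le_one.2 fun a ha b hb => Subtype.ext ((hsub a ha).trans (hsub b hb).symm)
  rw [h3] at this
  omega

theorem IsSphericalCode.exists_path (hC : IsSphericalCode 4 10 (1 / 6) C) :
    ∃ b : Fin 4 → EuclideanSpace ℝ (Fin 4), (∀ i, b i ∈ C) ∧ ∀ i j, ⟪b i, b j⟫ = pathGram i j := by
  have hne : C.Nonempty := by
    rw [← Set.encard_ne_zero, hC.1]
    norm_num
  obtain ⟨x, hx⟩ := hne
  obtain ⟨y, hy, -, hxy⟩ := hC.exists_neighbor_ne hx 0
  obtain ⟨y', hy', hyy', hxy'⟩ := hC.exists_neighbor_ne hx y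
  obtain ⟨z, hz, hzx, hyz⟩ := hC.exists_neighbor_ne hy x
  have nx := hC.norm_eq_one hx
  have ny := hC.norm_eq_one hy
  have ny' := hC.norm_eq_one hy'
  have nz := hC.norm_eq_one hz
  have e1 : ⟪y, y'⟫ = 1 / 6 := (hC.inner_eq hy hy' hyy'.symm).resolve_right fun h =>
    not_triangle nx ny ny' hxy h hxy'
  have e2 : ⟪z, x⟫ = 1 / 6 := (hC.inner_eq hz hx hzx).resolve_right fun h =>
    not_triangle ny nz nx hyz h (by rw [real_inner_comm, hxy])
  have hzy' : z ≠ y' := by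
    rintro rfl
    rw [hyz] at e1
    norm_num at e1
  have e3 : ⟪z, y'⟫ = 1 / 6 := (hC.inner_eq hz hy' hzy').resolve_right fun h =>
    not_four_cycle nx ny nz ny' hxy hyz h (by rw [real_inner_comm, hxy'])
      (by rw [real_inner_comm, e2]) e1.le
  refine ⟨![z, y, x, y'], ?_, ?_⟩
  · intro i
    fin_cases i <;> assumption
  · intro i j
    fin_cases i <;> fin_cases j <;>
      simp [pathGram, hxy, hxy', hyz, e1, e2, e3, nx, ny, ny', nz, real_inner_comm y z,
        real_inner_comm z x, real_inner_comm z y', real_inner_comm x y, real_inner_comm y y',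
        real_inner_comm x y']

theorem IsSphericalCode.inner_mem_pathProfiles (hC : IsSphericalCode 4 10 (1 / 6) C)
    {b : Fin 4 → EuclideanSpace ℝ (Fin 4)} (hbC : ∀ i, b i ∈ C)
    (hb : ∀ i j, ⟪b i, b j⟫ = pathGram i j) {v : EuclideanSpace ℝ (Fin 4)} (hv : v ∈ C) :
    (fun i => ⟪v, b i⟫) ∈ pathProfiles := by
  by_cases hvb : ∃ i, v = b i
  · obtain ⟨i, rfl⟩ := hvb
    have : (fun j => ⟪b i, b j⟫) = pathGram i := funext fun j => hb i j
    rw [this]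
    fin_cases i <;> simp [pathProfiles]
  push Not at hvb
  have nv := hC.norm_eq_one hv
  have nb := fun i => hC.norm_eq_one (hbC i)
  have b01 : ⟪b 0, b 1⟫ = -2 / 3 := by rw [hb]; simp [pathGram]
  have b12 : ⟪b 1, b 2⟫ = -2 / 3 := by rw [hb]; simp [pathGram]
  have b23 : ⟪b 2, b 3⟫ = -2 / 3 := by rw [hb]; simp [pathGram]
  have b02 : ⟪b 0, b 2⟫ = 1 / 6 := by rw [hb]; simp [pathGram]
  have b13 : ⟪b 1, b 3⟫ = 1 / 6 := by rw [hb]; simp [pathGram]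
  have hcases := fun i => hC.inner_eq hv (hbC i) (hvb i)
  have hle := fun i => hC.2.2 v hv (b i) (hbC i) (hvb i)
  have n01 : ⟪v, b 0⟫ = -2 / 3 → ⟪v, b 1⟫ = -2 / 3 → False := fun h0 h1 =>
    not_triangle nv (nb 0) (nb 1) h0 b01 h1
  have n12 : ⟪v, b 1⟫ = -2 / 3 → ⟪v, b 2⟫ = -2 / 3 → False := fun h0 h1 =>
    not_triangle nv (nb 1) (nb 2) h0 b12 h1
  have n23 : ⟪v, b 2⟫ = -2 / 3 → ⟪v, b 3⟫ = -2 / 3 → False := fun h0 h1 =>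
    not_triangle nv (nb 2) (nb 3) h0 b23 h1
  have n02 : ⟪v, b 0⟫ = -2 / 3 → ⟪v, b 2⟫ = -2 / 3 → False := fun h0 h1 =>
    not_four_cycle nv (nb 0) (nb 1) (nb 2) h0 b01 b12 (by rw [real_inner_comm, h1]) (hle 1) b02.le
  have n13 : ⟪v, b 1⟫ = -2 / 3 → ⟪v, b 3⟫ = -2 / 3 → False := fun h0 h1 =>
    not_four_cycle nv (nb 1) (nb 2) (nb 3) h0 b12 b23 (by rw [real_inner_comm, h1]) (hle 2) b13.le
  have hprof : (fun i => ⟪v, b i⟫) = ![⟪v, b 0⟫, ⟪v, b 1⟫, ⟪v, b 2⟫, ⟪v, b 3⟫] := by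
    funext i
    fin_cases i <;> rfl
  rw [hprof]
  rcases hcases 0 with h0 | h0 <;> rcases hcases 1 with h1 | h1 <;>
    rcases hcases 2 with h2 | h2 <;> rcases hcases 3 with h3 | h3 <;>
    first
    | exact (n01 h0 h1).elim
    | exact (n12 h1 h2).elim
    | exact (n23 h2 h3).elim
    | exact (n02 h0 h2).elim
    | exact (n13 h1 h3).elim
    | (rw [h0, h1, h2, h3]; simp [pathProfiles])

/-- There are no more profiles than points, and a point is determined by its profile, so every
profile occurs. -/
theorem IsSphericalCode.image_inner_eq_pathProfiles (hC : IsSphericalCode 4 10 (1 / 6) C)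
    {b : Fin 4 → EuclideanSpace ℝ (Fin 4)} (hbC : ∀ i, b i ∈ C)
    (hb : ∀ i j, ⟪b i, b j⟫ = pathGram i j) :
    (fun (v : EuclideanSpace ℝ (Fin 4)) i => ⟪v, b i⟫) '' C = pathProfiles := by
  have hinj : Function.Injective fun (v : EuclideanSpace ℝ (Fin 4)) i => ⟪v, b i⟫ := fun v w h =>
    ext_inner_of_linearIndependent (linearIndependent_of_inner_eq_pathGram hb) (congrFun h)
  refine ((Set.finite_of_encard_eq_coe hC.1).image _).eq_of_subset_of_encard_le ?_ ?_
  · rintro _ ⟨v, hv, rfl⟩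
    exact hC.inner_mem_pathProfiles hbC hb hv
  · rw [hinj.encard_image, hC.1, Set.encard_coe_eq_coe_finsetCard]
    exact_mod_cast card_pathProfiles_le

theorem IsSphericalCode.exists_linearIsometryEquiv {C C' : Set (EuclideanSpace ℝ (Fin 4))}
    (hC : IsSphericalCode 4 10 (1 / 6) C) (hC' : IsSphericalCode 4 10 (1 / 6) C') :
    ∃ U : EuclideanSpace ℝ (Fin 4) ≃ₗᵢ[ℝ] EuclideanSpace ℝ (Fin 4), U '' C = C' := by
  obtain ⟨b, hbC, hb⟩ := hC.exists_path
  obtain ⟨b', hbC', hb'⟩ := hC'.exists_path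
  have li := linearIndependent_of_inner_eq_pathGram hb
  have li' := linearIndependent_of_inner_eq_pathGram hb'
  obtain ⟨U, hU⟩ := exists_linearIsometryEquiv_of_inner_eq li li' fun i j => by rw [hb, hb']
  refine ⟨U, ((Set.finite_of_encard_eq_coe hC.1).image _).eq_of_subset_of_encard_le ?_ ?_⟩
  · rintro _ ⟨v, hv, rfl⟩
    have hmem : (fun i => ⟪U v, b' i⟫) ∈ (fun (v : EuclideanSpace ℝ (Fin 4)) i => ⟪v, b' i⟫) '' C' := by
      rw [hC'.image_inner_eq_pathProfiles hbC' hb', ← hC.image_inner_eq_pathProfiles hbC hb]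
      exact ⟨v, hv, funext fun i => by rw [← hU, U.inner_map_map]⟩
    obtain ⟨v', hv', h⟩ := hmem
    rwa [← ext_inner_of_linearIndependent li' (congrFun h)]
  · rw [U.injective.encard_image, hC.1, hC'.1]

end Uniqueness

/-! ### Petersen codes -/

section Petersen

/-- The midpoints of the edges of a regular simplex lie on the unit sphere around the origin only if
the simplex is centered at the origin. -/
theorem inner_points_of_edgeMidpoints_subset_sphere
    {s : Affine.Simplex ℝ (EuclideanSpace ℝ (Fin 4)) 4} (hs : s.Regular)
    (h : edgeMidpoints s ⊆ Metric.sphere 0 1) (i j : Fin 5) :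
    ⟪s.points i, s.points j⟫ = if i = j then 8 / 3 else -2 / 3 := by
  obtain ⟨r, hr⟩ := hs.equilateral
  have hr0 : r ≠ 0 := by
    rw [← hr 0 1 (by decide)]
    exact dist_ne_zero.2 (s.independent.injective.ne (by decide))
  set P : Fin 5 → EuclideanSpace ℝ (Fin 4) := s.points
  have hadd : ∀ i j, i < j → ⟪P i, P i⟫ + ⟪P j, P j⟫ + 2 * ⟪P i, P j⟫ = 4 := by
    intro i j hij
    have hm : midpoint ℝ (P i) (P j) ∈ Metric.sphere (0 : EuclideanSpace ℝ (Fin 4)) 1 :=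
      h ⟨i, j, hij, rfl⟩
    rw [mem_sphere_zero_iff_norm, midpoint_eq_smul_add, norm_smul] at hm
    have hn : ‖P i + P j‖ = 2 := by
      norm_num at hm
      linarith
    have hsq := norm_add_sq_real (P i) (P j)
    rw [hn] at hsq
    rw [real_inner_self_eq_norm_sq, real_inner_self_eq_norm_sq]
    linarith
  have hsub : ∀ i j, i < j → ⟪P i, P i⟫ + ⟪P j, P j⟫ - 2 * ⟪P i, P j⟫ = r ^ 2 := by
    intro i j hij
    have hsq := norm_sub_sq_real (P i) (P j)
    rw [← dist_eq_norm, hr i j hij.ne] at hsq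
    rw [real_inner_self_eq_norm_sq, real_inner_self_eq_norm_sq]
    linarith
  have hnorm : ∀ i, ⟪P i, P i⟫ = 1 + r ^ 2 / 4 := by
    have h01 : (0 : Fin 5) < 1 := by decide
    have h12 : (1 : Fin 5) < 2 := by decide
    have h02 : (0 : Fin 5) < 2 := by decide
    have h0 : ⟪P 0, P 0⟫ = 1 + r ^ 2 / 4 := by
      linarith [hadd _ _ h01, hsub _ _ h01, hadd _ _ h12, hsub _ _ h12, hadd _ _ h02, hsub _ _ h02]
    intro i
    rcases eq_or_ne i 0 with rfl | hi
    · exact h0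
    · have hi' : (0 : Fin 5) < i := Fin.pos_iff_ne_zero.2 hi
      linarith [hadd _ _ hi', hsub _ _ hi']
  have hgram : ∀ i j, ⟪P i, P j⟫ = (1 - r ^ 2 / 4) + if i = j then r ^ 2 / 2 else 0 := by
    intro i j
    rcases lt_trichotomy i j with hij | rfl | hij
    · rw [if_neg hij.ne]
      linarith [hadd _ _ hij, hsub _ _ hij]
    · rw [if_pos rfl, hnorm]
      ring
    · rw [if_neg hij.ne', real_inner_comm]
      linarith [hadd _ _ hij, hsub _ _ hij]
  -- Five vectors of `ℝ⁴` are linearly dependent, so their Gram matrix is singular.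
  have hr2 : r ^ 2 = 20 / 3 := by
    have hdep : ¬ LinearIndependent ℝ P := fun hli => by
      have := hli.fintype_card_le_finrank
      simp at this
    obtain ⟨g, hg, k, hk⟩ := Fintype.not_linearIndependent_iff.1 hdep
    have hj : ∀ j, (1 - r ^ 2 / 4) * ∑ i, g i + r ^ 2 / 2 * g j = 0 := by
      intro j
      have := congrArg (fun v => ⟪v, P j⟫) hg
      simp only [sum_inner, real_inner_smul_left, hgram, mul_add, Finset.sum_add_distrib, mul_ite,
        mul_zero, Finset.sum_ite_eq', Finset.mem_univ, if_true, inner_zero_left,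
        ← Finset.sum_mul] at this
      linarith
    have hsum : ∑ j, ((1 - r ^ 2 / 4) * ∑ i, g i + r ^ 2 / 2 * g j) = 0 :=
      Finset.sum_eq_zero fun j _ => hj j
    simp only [Finset.sum_add_distrib, ← Finset.mul_sum, Finset.sum_const, Finset.card_univ, Fintype.card_fin, nsmul_eq_mul] at hsum
    push_cast at hsum
    have hprod : (∑ i, g i) * (5 - 3 / 4 * r ^ 2) = 0 := by linarith
    rcases mul_eq_zero.1 hprod with h0 | h0
    · have := hj k
      rw [h0, mul_zero, zero_add] at this
      exact absurd this (by positivity)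
    · linarith
  rw [hgram, hr2]
  split_ifs <;> norm_num

variable {P : Fin 5 → EuclideanSpace ℝ (Fin 4)}

theorem inner_midpoint_midpoint (hP : ∀ i j, ⟪P i, P j⟫ = if i = j then 8 / 3 else -2 / 3)
    (i j k l : Fin 5) :
    ⟪midpoint ℝ (P i) (P j), midpoint ℝ (P k) (P l)⟫
      = ((if i = k then 8 / 3 else -2 / 3) + (if i = l then 8 / 3 else -2 / 3)
        + (if j = k then 8 / 3 else -2 / 3) + (if j = l then 8 / 3 else -2 / 3)) / 4 := by
  simp only [midpoint_eq_smul_add, real_inner_smul_left, real_inner_smul_right, inner_add_left,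
    inner_add_right, hP]
  norm_num
  ring

theorem inner_midpoint_self (hP : ∀ i j, ⟪P i, P j⟫ = if i = j then 8 / 3 else -2 / 3)
    {i j : Fin 5} (hij : i ≠ j) :
    ⟪midpoint ℝ (P i) (P j), midpoint ℝ (P i) (P j)⟫ = 1 := by
  rw [inner_midpoint_midpoint hP]
  simp only [hij, hij.symm, if_true, if_false]
  norm_num

theorem inner_midpoint_of_ne (hP : ∀ i j, ⟪P i, P j⟫ = if i = j then 8 / 3 else -2 / 3)
    {i j k l : Fin 5} (hij : i < j) (hkl : k < l) (hne : ¬ (i = k ∧ j = l)) :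
    ⟪midpoint ℝ (P i) (P j), midpoint ℝ (P k) (P l)⟫ = -2 / 3 ∨
      ⟪midpoint ℝ (P i) (P j), midpoint ℝ (P k) (P l)⟫ = 1 / 6 := by
  rw [inner_midpoint_midpoint hP]
  split_ifs <;> first | (exfalso; omega) | norm_num

theorem IsPetersenCode.isSphericalCode_and_inner {C : Set (EuclideanSpace ℝ (Fin 4))}
    (hC : IsPetersenCode C) : IsSphericalCode 4 10 (1 / 6) C ∧
      {r : ℝ | ∃ x ∈ C, ∃ y ∈ C, x ≠ y ∧ ⟪x, y⟫ = r} = {-2 / 3, 1 / 6} := by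
  obtain ⟨s, hs, rfl, hsph⟩ := hC
  have hP := inner_points_of_edgeMidpoints_subset_sphere hs hsph
  have hinner : ∀ x ∈ edgeMidpoints s, ∀ y ∈ edgeMidpoints s, x ≠ y →
      ⟪x, y⟫ = -2 / 3 ∨ ⟪x, y⟫ = 1 / 6 := by
    rintro _ ⟨i, j, hij, rfl⟩ _ ⟨k, l, hkl, rfl⟩ hne
    refine inner_midpoint_of_ne hP hij hkl ?_
    rintro ⟨rfl, rfl⟩
    exact hne rfl
  have hval : ∀ i j k l : Fin 5, i < j → k < l → ¬ (i = k ∧ j = l) →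
      midpoint ℝ (s.points i) (s.points j) ≠ midpoint ℝ (s.points k) (s.points l) := by
    intro i j k l hij hkl hne heq
    have h1 := inner_midpoint_self hP hij.ne
    have h2 := inner_midpoint_of_ne hP hij hkl hne
    rw [← heq, h1] at h2
    norm_num at h2
  refine ⟨⟨?_, hsph, ?_⟩, ?_⟩
  · have himage : edgeMidpoints s = (fun q : Fin 5 × Fin 5 => midpoint ℝ (s.points q.1) (s.points q.2))
        '' (Finset.univ.filter fun q : Fin 5 × Fin 5 => q.1 < q.2 : Finset (Fin 5 × Fin 5)) := by
      ext x
      constructor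
      · rintro ⟨i, j, hij, rfl⟩
        exact ⟨(i, j), by simpa using hij, rfl⟩
      · rintro ⟨⟨i, j⟩, hij, rfl⟩
        exact ⟨i, j, by simpa using hij, rfl⟩
    rw [himage, Set.InjOn.encard_image, Set.encard_coe_eq_coe_finsetCard]
    · rfl
    · rintro ⟨i, j⟩ hij ⟨k, l⟩ hkl heq
      by_contra hne
      exact hval i j k l (by simpa using hij) (by simpa using hkl) (by simpa using hne) heq
  · intro x hx y hy hxy
    rcases hinner x hx y hy hxy with h | h <;> exact h.le.trans (by norm_num)
  · ext r
    constructor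
    · rintro ⟨x, hx, y, hy, hxy, rfl⟩
      exact hinner x hx y hy hxy
    · rintro (rfl | rfl)
      · refine ⟨_, ⟨0, 1, by decide, rfl⟩, _, ⟨2, 3, by decide, rfl⟩,
          hval 0 1 2 3 (by decide) (by decide) (by decide), ?_⟩
        rw [inner_midpoint_midpoint hP]
        simp
        norm_num
      · refine ⟨_, ⟨0, 1, by decide, rfl⟩, _, ⟨0, 2, by decide, rfl⟩,
          hval 0 1 0 2 (by decide) (by decide) (by decide), ?_⟩
        rw [inner_midpoint_midpoint hP]
        simp
        norm_num

/-! ### Existence -/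

theorem affineIndependent_of_inner_eq
    (hP : ∀ i j, ⟪P i, P j⟫ = if i = j then 8 / 3 else -2 / 3) : AffineIndependent ℝ P := by
  rw [affineIndependent_iff]
  intro t w hw hwP j hj
  have h : ∀ i, ⟪P i, P j⟫ = -2 / 3 + if i = j then 10 / 3 else 0 := by
    intro i
    rw [hP]
    split_ifs <;> norm_num
  have := congrArg (fun v => ⟪v, P j⟫) hwP
  simp only [sum_inner, real_inner_smul_left, h, mul_add, Finset.sum_add_distrib, mul_ite, mul_zero,
    Finset.sum_ite_eq', hj, if_true, inner_zero_left, ← Finset.sum_mul, hw] at this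
  linarith

theorem linearIndependent_castSucc_of_inner_eq
    (hP : ∀ i j, ⟪P i, P j⟫ = if i = j then 8 / 3 else -2 / 3) :
    LinearIndependent ℝ fun i : Fin 4 => P i.castSucc := by
  rw [Fintype.linearIndependent_iff]
  intro g hg
  have h : ∀ j, ∑ i : Fin 4, g i * ⟪P i.castSucc, P j⟫ = 0 := by
    intro j
    have := congrArg (fun v => ⟪v, P j⟫) hg
    simpa only [sum_inner, real_inner_smul_left, inner_zero_left] using this
  -- Pairing with the omitted point shows that the coefficients sum to zero.
  have hlast := h (Fin.last 4)
  simp only [hP, (Fin.castSucc_lt_last _).ne, if_false, ← Finset.sum_mul] at hlast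
  intro j
  have hv : ∀ i : Fin 4, ⟪P i.castSucc, P j.castSucc⟫ = -2 / 3 + if i = j then 10 / 3 else 0 := by
    intro i
    rw [hP]
    simp only [Fin.castSucc_inj]
    split_ifs <;> norm_num
  have hj := h j.castSucc
  simp only [hv, mul_add, Finset.sum_add_distrib, mul_ite, mul_zero, Finset.sum_ite_eq',
    Finset.mem_univ, if_true, ← Finset.sum_mul] at hj
  linarith

theorem regular_of_inner_eq {s : Affine.Simplex ℝ (EuclideanSpace ℝ (Fin 4)) 4}
    (hs : ∀ i j, ⟪s.points i, s.points j⟫ = if i = j then 8 / 3 else -2 / 3) : s.Regular := by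
  intro σ
  have hσ : ∀ i j, ⟪s.points (σ i), s.points (σ j)⟫ = if i = j then 8 / 3 else -2 / 3 := by
    intro i j
    rw [hs]
    simp only [σ.injective.eq_iff]
  have li := linearIndependent_castSucc_of_inner_eq hs
  have li' := linearIndependent_castSucc_of_inner_eq (P := fun i => s.points (σ i)) hσ
  obtain ⟨U, hU⟩ := exists_linearIsometryEquiv_of_inner_eq li li' fun i j => by rw [hs, hσ]
  refine ⟨U.toIsometryEquiv, funext fun i => ?_⟩
  change s.points (σ i) = U (s.points i)
  refine ext_inner_of_linearIndependent li' fun j => ?_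
  rw [← hU, U.inner_map_map, hs, hU, hσ]

/-- The vertices of a pyramid centered at the origin over a regular tetrahedron whose vertices are
alternate vertices of a cube with edges `2 * α`. For suitable `α` and `h` it is regular. -/
def pyramid (α h : ℝ) : Fin 5 → EuclideanSpace ℝ (Fin 4) :=
  ![!₂[α, α, α, h], !₂[α, -α, -α, h], !₂[-α, α, -α, h], !₂[-α, -α, α, h], !₂[0, 0, 0, -4 * h]]

theorem inner_pyramid {α h : ℝ} (hα : α ^ 2 = 5 / 6) (hh : h ^ 2 = 1 / 6) (i j : Fin 5) :
    ⟪pyramid α h i, pyramid α h j⟫ = if i = j then 8 / 3 else -2 / 3 := by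
  simp only [PiLp.inner_apply, Fin.sum_univ_four]
  fin_cases i <;> fin_cases j <;> simp [pyramid, mul_pow] <;> nlinarith

theorem exists_isPetersenCode : ∃ C : Set (EuclideanSpace ℝ (Fin 4)), IsPetersenCode C := by
  have hP := inner_pyramid (Real.sq_sqrt (by norm_num : (0 : ℝ) ≤ 5 / 6))
    (Real.sq_sqrt (by norm_num : (0 : ℝ) ≤ 1 / 6))
  let s : Affine.Simplex ℝ (EuclideanSpace ℝ (Fin 4)) 4 := ⟨_, affineIndependent_of_inner_eq hP⟩
  refine ⟨edgeMidpoints s, s, regular_of_inner_eq (s := s) hP, rfl, ?_⟩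
  rintro _ ⟨i, j, hij, rfl⟩
  have := inner_midpoint_self hP hij.ne
  rw [mem_sphere_zero_iff_norm]
  rw [real_inner_self_eq_norm_sq] at this
  exact (pow_eq_one_iff_of_nonneg (norm_nonneg _) two_ne_zero).1 this

end Petersen

/-- The Petersen code exists, is an optimal `(4, 10, 1/6)` spherical code whose inner products
between distinct points are `-2/3` and `1/6`, and every `(4, 10, 1/6)` spherical code is its image
under an orthogonal transformation. -/
theorem theorem1 :
    (∃ C : Set (EuclideanSpace ℝ (Fin 4)), IsPetersenCode C) ∧
    ∀ C : Set (EuclideanSpace ℝ (Fin 4)), IsPetersenCode C →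
      IsOptimalSphericalCode 4 10 (1 / 6) C ∧
      {r : ℝ | ∃ x ∈ C, ∃ y ∈ C, x ≠ y ∧ inner ℝ x y = r} = {-2 / 3, 1 / 6} ∧
      ∀ C' : Set (EuclideanSpace ℝ (Fin 4)), IsSphericalCode 4 10 (1 / 6) C' →
        ∃ U : EuclideanSpace ℝ (Fin 4) ≃ₗᵢ[ℝ] EuclideanSpace ℝ (Fin 4), U '' C = C' := by
  refine ⟨exists_isPetersenCode, fun C hP => ?_⟩
  obtain ⟨hC, hset⟩ := hP.isSphericalCode_and_inner
  refine ⟨⟨hC, ?_⟩, hset, fun C' hC' => hC.exists_linearIsometryEquiv hC'⟩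
  -- A better code would also be a `(4, 10, 1 / 6)` code, hence congruent to `C`.
  rintro t' ht' ⟨C', hC'⟩
  obtain ⟨U, rfl⟩ := hC.exists_linearIsometryEquiv
    ⟨hC'.1, hC'.2.1, fun x hx y hy hxy => (hC'.2.2 x hx y hy hxy).trans ht'.le⟩
  have hmem : (1 / 6 : ℝ) ∈ {r : ℝ | ∃ x ∈ C, ∃ y ∈ C, x ≠ y ∧ ⟪x, y⟫ = r} := by
    rw [hset]
    simp
  obtain ⟨x, hx, y, hy, hxy, h⟩ := hmem
  have := hC'.2.2 (U x) ⟨x, hx, rfl⟩ (U y) ⟨y, hy, rfl⟩ (U.injective.ne hxy)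
  rw [U.inner_map_map, h] at this
  linarith
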